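/- **Theorem (Glasner–Weiss).** Let $S_\infty$ be the group of all permutations of $\omega$, with the topology induced from the Baire space $\omega^\omega$, and let $\mathrm{LO}\subseteq 2^{\omega\times\omega}$ be the compact space of all (strict) linear orderings of $\omega$, on which $S_\infty$ acts by $$ i\,(\sigma\cdot{\prec})\,j \iff \sigma^{-1}(i)\prec\sigma^{-1}(j). $$ For a topological group $G$, a $G$-flow is a continuous action of $G$ on a nonempty compact Hausdorff space; it is minimal if every orbit is dense; a minimal $G$-flow is universal if it admits a continuous $G$-equivariant map to every minimal $G$-flow; two $G$-flows are isomorphic if there is a $G$-equivariant homeomorphism between them. Then: 1. $S_\infty\curvearrowright\mathrm{LO}$ is a universal minimal flow of $S_\infty$. 2. Every universal minimal flow of $S_\infty$ is isomorphic to $S_\infty\curvearrowright\mathrm{LO}$. Thus $S_\infty\curvearrowright\mathrm{LO}$ is the universal minimal flow $M(S_\infty)$. 3. Identify $\mathbb{Q}$ with $\omega$ by any bijection, and let $\mathrm{Aut}(\mathbb{Q})\le S_\infty$ be the subgroup of permutations that preserve the order of $\mathbb{Q}$. Then $\mathrm{Aut}(\mathbb{Q})$ is extremely amenable (each of its flows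 has a fixed point). Moreover $\mathrm{Aut}(\mathbb{Q})$ is co-precompact in $S_\infty$: the completion $\widehat{S_\infty/\mathrm{Aut}(\mathbb{Q})}$ of the coset space is compact, where the coset space carries the uniformity generated by the entourages $\{(fH,ufH): f\in S_\infty,\ u\in U\}$, with $H=\mathrm{Aut}(\mathbb{Q})$ and $U$ an open neighborhood of the identity. Finally, this completion, with the extension of the left translation action of $S_\infty$, is isomorphic as an $S_\infty$-flow to $S_\infty\curvearrowright\mathrm{LO}$. -/

import Mathlib

open Topology Filter Uniformity

universe u v w

namespace TopDyn

/-! ## Flows -/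

section Flows

variable (G : Type*) [Group G] [TopologicalSpace G]

/-- A `G`-flow: a continuous action of `G` on a nonempty compact Hausdorff space `X`. -/
structure IsFlow (X : Type*) [TopologicalSpace X] [MulAction G X] : Prop where
  nonempty : Nonempty X
  compact : CompactSpace X
  t2 : T2Space X
  continuous_smul : ContinuousSMul G X

/-- A `G`-flow is minimal if every orbit is dense. -/
structure IsMinimalFlow (X : Type*) [TopologicalSpace X] [MulAction G X] : Prop
    extends IsFlow G X where
  dense_orbit : ∀ x : X, Dense (MulAction.orbit G x)

/-- Two flows are isomorphic if there is an equivariant homeomorphism between them. -/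
def FlowIsomorphic (X Y : Type*) [TopologicalSpace X] [MulAction G X]
    [TopologicalSpace Y] [MulAction G Y] : Prop :=
  ∃ Φ : X ≃ₜ Y, ∀ (g : G) (x : X), Φ (g • x) = g • Φ x

end Flows

/-- A minimal flow is universal if it maps continuously and equivariantly to every minimal flow
(the minimal flows range over an arbitrary universe `w`). -/
structure IsUniversalMinimalFlow (G : Type u) [Group G] [TopologicalSpace G]
    (X : Type v) [TopologicalSpace X] [MulAction G X] : Prop extends IsMinimalFlow G X where
  exists_map : ∀ (Y : Type w) [TopologicalSpace Y] [MulAction G Y], IsMinimalFlow G Y →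
    ∃ π : X → Y, Continuous π ∧ ∀ (g : G) (x : X), π (g • x) = g • π x

/-- A topological group is extremely amenable if each of its flows has a fixed point
(the flows range over an arbitrary universe `w`). -/
def IsExtremelyAmenable (G : Type u) [Group G] [TopologicalSpace G] : Prop :=
  ∀ (X : Type w) [TopologicalSpace X] [MulAction G X], IsFlow G X →
    ∃ x : X, ∀ g : G, g • x = x

/-! ## The uniformity on a coset space and co-precompact subgroups -/

section Cosets

variable {G : Type*} [Group G] [TopologicalSpace G]

/-- The filter generated by the entourages `{(x, u • x) | u ∈ U, x ∈ G ⧸ H}`, where `U` runs over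
the neighbourhoods of `1` in `G`. -/
def cosetUniformity (H : Subgroup G) : Filter ((G ⧸ H) × (G ⧸ H)) :=
  Filter.map (fun p : G × (G ⧸ H) => (p.2, p.1 • p.2)) (𝓝 (1 : G) ×ˢ ⊤)

theorem mem_cosetUniformity {H : Subgroup G} {s : Set ((G ⧸ H) × (G ⧸ H))} :
    s ∈ cosetUniformity H ↔ ∃ U ∈ 𝓝 (1 : G), ∀ u ∈ U, ∀ x : G ⧸ H, (x, u • x) ∈ s := by
  unfold cosetUniformity
  rw [Filter.mem_map, ← Filter.principal_univ, Filter.mem_prod_principal]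
  constructor
  · intro h
    exact ⟨_, h, fun u hu x => hu x (Set.mem_univ x)⟩
  · rintro ⟨U, hU, h⟩
    exact Filter.mem_of_superset hU fun u hu x _ => h u hu x

variable [IsTopologicalGroup G]

/-- The uniform structure on `G ⧸ H` induced by the right uniformity of `G`; it is compatible with
the quotient topology. -/
instance cosetUniformSpace (H : Subgroup G) : UniformSpace (G ⧸ H) where
  toTopologicalSpace := QuotientGroup.instTopologicalSpace H
  uniformity := cosetUniformity H
  symm := by
    intro s hs
    obtain ⟨U, hU, h⟩ := mem_cosetUniformity.1 hs
    refine mem_cosetUniformity.2 ⟨U⁻¹, inv_mem_nhds_one G hU, fun u hu x => ?_⟩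
    simpa using h u⁻¹ hu (u • x)
  comp := by
    intro s hs
    obtain ⟨U, hU, h⟩ := mem_cosetUniformity.1 hs
    obtain ⟨V, hV, hVU⟩ := exists_nhds_one_split hU
    rw [Filter.mem_lift'_sets (by
      intro a b hab
      exact SetRel.comp_subset_comp hab hab)]
    refine ⟨{p | ∃ u ∈ V, p.2 = u • p.1},
      mem_cosetUniformity.2 ⟨V, hV, fun u hu x => ⟨u, hu, rfl⟩⟩, ?_⟩
    rintro ⟨x, z⟩ ⟨y, ⟨a, ha, hy⟩, ⟨b, hb, hz⟩⟩
    simp only at hy hz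
    subst hy
    subst hz
    rw [smul_smul]
    exact h _ (hVU b hb a ha) x
  nhds_eq_comap_uniformity := by
    intro x
    induction x using QuotientGroup.induction_on with
    | H f =>
      rw [QuotientGroup.nhds_eq]
      ext s
      rw [Filter.mem_map, Filter.mem_comap, ← map_mul_right_nhds_one f, Filter.mem_map]
      constructor
      · intro hs
        refine ⟨{p | p.1 = (f : G ⧸ H) → p.2 ∈ s},
          mem_cosetUniformity.2 ⟨_, hs, ?_⟩, fun y hy => hy rfl⟩
        rintro u hu x (rfl : x = _)
        exact hu
      · rintro ⟨t, ht, hts⟩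
        obtain ⟨U, hU, h⟩ := mem_cosetUniformity.1 ht
        exact Filter.mem_of_superset hU fun u hu => hts (h u hu (f : G ⧸ H))

/-- Left translations of `G ⧸ H` are uniformly continuous, so that the action of `G` extends to
the completion of `G ⧸ H`. -/
instance cosetUniformContinuousConstSMul (H : Subgroup G) :
    UniformContinuousConstSMul G (G ⧸ H) where
  uniformContinuous_const_smul := by
    intro g s hs
    obtain ⟨U, hU, h⟩ := mem_cosetUniformity.1 hs
    refine mem_cosetUniformity.2 ⟨(fun u => g * u * g⁻¹) ⁻¹' U, ?_, fun u hu x => ?_⟩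
    · have hc : Continuous fun u : G => g * u * g⁻¹ := by fun_prop
      exact hc.continuousAt.preimage_mem_nhds (by simpa using hU)
    · have := h _ hu (g • x)
      simpa [smul_smul] using this

/-- `H` is co-precompact in `G` if the completion of `G ⧸ H` is compact. -/
def IsCoprecompact (H : Subgroup G) : Prop :=
  CompactSpace (UniformSpace.Completion (G ⧸ H))

end Cosets

/-! ## The group of all permutations of the natural numbers -/

/-- The group of all permutations of `ℕ`, under composition. -/
abbrev Sinf : Type := Equiv.Perm ℕ

/-- The topology induced by the inclusion into the Baire space `ℕ → ℕ`. -/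
instance : TopologicalSpace Sinf :=
  TopologicalSpace.induced (fun σ : Sinf => (σ : ℕ → ℕ)) inferInstance

theorem continuous_Sinf_apply (i : ℕ) : Continuous fun σ : Sinf => σ i :=
  (continuous_apply i).comp continuous_induced_dom

theorem continuous_to_Sinf {X : Type*} [TopologicalSpace X] {f : X → Sinf}
    (h : ∀ i : ℕ, Continuous fun x => f x i) : Continuous f :=
  continuous_induced_rng.2 (continuous_pi h)

theorem Sinf_eventually_apply (σ : Sinf) (i : ℕ) : ∀ᶠ τ in 𝓝 σ, τ i = σ i :=
  (continuous_Sinf_apply i).continuousAt.eventually (mem_of_superset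
    ((isOpen_discrete {σ i}).mem_nhds rfl) fun _ h => h)

instance : IsTopologicalGroup Sinf where
  continuous_mul := by
    refine continuous_to_Sinf fun i => ?_
    rw [continuous_iff_continuousAt]
    rintro ⟨σ, τ⟩
    refine ContinuousAt.congr (f := fun _ => σ (τ i)) continuousAt_const ?_
    have h1 := (continuous_snd.tendsto (σ, τ)).eventually (Sinf_eventually_apply τ i)
    have h2 := (continuous_fst.tendsto (σ, τ)).eventually (Sinf_eventually_apply σ (τ i))
    filter_upwards [h1, h2] with p hp1 hp2
    rw [Equiv.Perm.mul_apply, hp1, hp2]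
  continuous_inv := by
    refine continuous_to_Sinf fun i => ?_
    rw [continuous_iff_continuousAt]
    intro σ
    refine ContinuousAt.congr (f := fun _ => σ⁻¹ i) continuousAt_const ?_
    filter_upwards [Sinf_eventually_apply σ (σ⁻¹ i)] with τ hτ
    rw [Equiv.Perm.eq_inv_iff_eq, hτ]
    simp

/-! ## The space of linear orderings -/

/-- The set of (strict) linear orderings of `ℕ`, as a subset of `2^(ℕ × ℕ)`. Its coercion to a type
carries the subspace topology of the product topology. -/
def LO : Set (ℕ × ℕ → Bool) :=
  {r | IsStrictTotalOrder ℕ fun i j => r (i, j) = true}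

/-- The action of permutations on linear orderings:
`i (σ • r) j` if and only if `(σ⁻¹ i) r (σ⁻¹ j)`. -/
instance : MulAction Sinf LO where
  smul σ r := ⟨fun p => r.1 (σ⁻¹ p.1, σ⁻¹ p.2), by
    have h : IsStrictTotalOrder ℕ fun i j => r.1 (i, j) = true := r.2
    exact
      { trichotomous := fun a b h1 h2 =>
          (σ⁻¹).injective (h.trichotomous (σ⁻¹ a) (σ⁻¹ b) h1 h2)
        irrefl := fun a => h.irrefl (σ⁻¹ a)
        trans := fun a b c => h.trans (σ⁻¹ a) (σ⁻¹ b) (σ⁻¹ c) }⟩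
  one_smul _ := rfl
  mul_smul _ _ _ := rfl

/-! ## The automorphism group of the ordered set of rational numbers -/

/-- `Aut(ℚ, <)` as a group of permutations of `ℕ`, after `ℚ` has been enumerated by a bijection
`e : ℕ ≃ ℚ`. -/
def autQ (e : ℕ ≃ ℚ) : Subgroup Sinf where
  carrier := {σ | ∀ i j : ℕ, e (σ i) < e (σ j) ↔ e i < e j}
  one_mem' _ _ := Iff.rfl
  mul_mem' {σ τ} hσ hτ i j := (hσ (τ i) (τ j)).trans (hτ i j)
  inv_mem' {σ} hσ i j := by simpa using (hσ (σ⁻¹ i) (σ⁻¹ j)).symm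

end TopDyn

open TopDyn

/-! Write `H` for `autQ e` and `<` for `rationalOrder e`. Everything rests on two facts about `H`.

Extreme amenability (`isExtremelyAmenable_autQ`): up to a small error, `g • x₀` depends only on the
finite set `g⁻¹ A`, so a finite net of the compact space colours finite sets. Ramsey's theorem
(`exists_monochromatic`) gives almost fixed points, and compactness gives a fixed one.

Homogeneity of `ℚ`: if `σ • <` and `τ • <` agree on a finite set, the cosets `σH` and `τH` differ by
a permutation fixing that set pointwise. So `σH ↦ σ • <` induces the coset uniformity, and its image
is dense in the compact space `LO`, which is therefore the completion.

In any flow an `H`-fixed point `y` gives a uniformly continuous map `σH ↦ σ • y`, which extends to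
`LO`; this is universality. For uniqueness, a continuous equivariant self-map of `LO` sends `<` to
an `H`-fixed order, hence to `<` or its reverse. It is thus the identity or order reversal, so
injective, and `LO → M → LO` forces `LO → M` to be bijective. -/

namespace TopDyn

/-! ## Ramsey's theorem -/

/-- The ultrafilter limit of a finite colouring of the one-point extensions of a finite set. -/
theorem exists_limitColour {α κ : Type*} [DecidableEq α] [Finite κ] (p : Ultrafilter α)
    (χ : Finset α → κ) : ∃ χ' : Finset α → κ,
    ∀ s, ∀ᶠ y in (p : Filter α), χ (insert y s) = χ' s := by
  suffices h : ∀ s, ∃ c, ∀ᶠ y in (p : Filter α), χ (insert y s) = c by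
    choose χ' h using h
    exact ⟨χ', h⟩
  intro s
  obtain ⟨c, hc⟩ := Ultrafilter.eq_pure_of_finite (p.map fun y => χ (insert y s))
  refine ⟨c, ?_⟩
  have h : {c} ∈ p.map fun y => χ (insert y s) := by
    rw [hc]
    exact Set.mem_singleton c
  exact h

/-- Ramsey's theorem: a finite colouring of the `n`-element subsets of an infinite type is constant
on the `n`-element subsets of arbitrarily large finite sets, with a colour that does not depend on
their size. -/
theorem exists_monochromatic {α κ : Type*} [DecidableEq α] [Infinite α] [Finite κ]
    (χ : Finset α → κ) (n : ℕ) :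
    ∃ c, ∀ N, ∃ S : Finset α, S.card = N ∧ ∀ s ⊆ S, s.card = n → χ s = c := by
  choose L hL using exists_limitColour (κ := κ) (hyperfilter α)
  -- `L^[j] χ s` is the colour of `s` after adding `j` generic points; the colour of `n` generic
  -- points does not depend on `N`.
  refine ⟨L^[n] χ ∅, fun N => ?_⟩
  suffices h : ∃ S : Finset α, S.card = N ∧
      ∀ s ⊆ S, ∀ j, s.card + j = n → L^[j] χ s = L^[n] χ ∅ by
    obtain ⟨S, hS, h⟩ := h
    exact ⟨S, hS, fun s hs hn => h s hs 0 hn⟩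
  induction N with
  | zero =>
    refine ⟨∅, rfl, fun s hs j hj => ?_⟩
    obtain rfl := Finset.subset_empty.1 hs
    simp only [Finset.card_empty, zero_add] at hj
    rw [hj]
  | succ N ih =>
    obtain ⟨S, hS, h⟩ := ih
    have h1 : ∀ᶠ y in (hyperfilter α : Filter α), y ∉ S :=
      compl_mem_hyperfilter_of_finite S.finite_toSet
    -- Only finitely many pairs `(s, j)` occur, so one new point is generic for all of them.
    have h2 : ∀ᶠ y in (hyperfilter α : Filter α), ∀ s ∈ S.powerset, ∀ j ∈ Finset.range n,
        (L^[j] χ) (insert y s) = L (L^[j] χ) s := by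
      rw [Filter.eventually_all_finset]
      intro s _
      rw [Filter.eventually_all_finset]
      exact fun j _ => hL _ s
    obtain ⟨y, hy, hyL⟩ := (h1.and h2).exists
    refine ⟨insert y S, by rw [Finset.card_insert_of_notMem hy, hS], fun s hs j hj => ?_⟩
    by_cases hys : y ∈ s
    · have hsub : s.erase y ⊆ S := by
        rw [← Finset.subset_insert_iff]
        exact hs
      have hcard := Finset.card_erase_add_one hys
      have := hyL _ (Finset.mem_powerset.2 hsub) j (Finset.mem_range.2 (by omega))
      rw [Finset.insert_erase hys, ← Function.iterate_succ_apply' L] at this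
      rw [this]
      exact h _ hsub _ (by omega)
    · exact h s ((Finset.subset_insert_iff_of_notMem hys).1 hs) j hj

/-! ## Homogeneity of the rational order -/

/-- A finite partial isomorphism between countable dense linear orders without endpoints extends to
an isomorphism. -/
theorem exists_orderIso_extending {α β : Type*} [LinearOrder α] [LinearOrder β]
    [Countable α] [DenselyOrdered α] [NoMinOrder α] [NoMaxOrder α] [Nonempty α]
    [Countable β] [DenselyOrdered β] [NoMinOrder β] [NoMaxOrder β] [Nonempty β]
    (f₀ : Order.PartialIso α β) : ∃ g : α ≃o β, ∀ p ∈ f₀.1, g p.1 = p.2 := by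
  cases nonempty_encodable α
  cases nonempty_encodable β
  let 𝒟 : α ⊕ β → Order.Cofinal (Order.PartialIso α β) := fun p =>
    Sum.recOn p (Order.PartialIso.definedAtLeft β) (Order.PartialIso.definedAtRight α)
  let I := Order.idealOfCofinals f₀ 𝒟
  let F a := Order.PartialIso.funOfIdeal a I
    (Order.cofinal_meets_idealOfCofinals _ 𝒟 (Sum.inl a))
  let G b := Order.PartialIso.invOfIdeal b I
    (Order.cofinal_meets_idealOfCofinals _ 𝒟 (Sum.inr b))
  refine ⟨OrderIso.ofCmpEqCmp (fun a => (F a).val) (fun b => (G b).val) fun a b => ?_, ?_⟩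
  · rcases (F a).prop with ⟨f, hf, ha⟩
    rcases (G b).prop with ⟨g, hg, hb⟩
    rcases I.directed _ hf _ hg with ⟨m, _, fm, gm⟩
    exact m.prop (a, _) (fm ha) (_, b) (gm hb)
  · rintro ⟨a, b⟩ hab
    rcases (F a).prop with ⟨f, hf, ha⟩
    rcases I.directed _ hf _ (Order.mem_idealOfCofinals f₀ 𝒟) with ⟨m, _, fm, gm⟩
    -- `m` extends `f₀` and is a partial isomorphism, so the two values it gives at `a` coincide.
    have := m.prop (a, _) (fm ha) (a, b) (gm hab)
    rw [cmp_self_eq_eq] at this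
    exact (cmp_eq_eq_iff _ _).1 this.symm

/-- Strictly monotone maps with the same image of a finite set agree on it. -/
theorem eqOn_of_strictMonoOn_of_image_eq {α β : Type*} [LinearOrder α] [LinearOrder β]
    {A : Finset α} {f g : α → β} (hf : StrictMonoOn f A) (hg : StrictMonoOn g A)
    (h : A.image f = A.image g) : ∀ a ∈ A, f a = g a := by
  -- The increasing enumeration of a finite set is unique, and `k` carries that of `A` to that of
  -- its image.
  have key : ∀ k : α → β, StrictMonoOn k A → A.image k = A.image f →
      ∀ i, k (A.orderEmbOfFin rfl i) =
        (A.image f).orderEmbOfFin (Finset.card_image_of_injOn hf.injOn) i := by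
    intro k hk hkf i
    refine congrFun (Finset.orderEmbOfFin_unique (f := fun i => k (A.orderEmbOfFin rfl i)) _
      (fun i => ?_) fun i j hij => ?_) i
    · rw [← hkf]
      exact Finset.mem_image_of_mem _ (Finset.orderEmbOfFin_mem _ _ _)
    · exact hk (Finset.orderEmbOfFin_mem _ _ _) (Finset.orderEmbOfFin_mem _ _ _)
        ((A.orderEmbOfFin rfl).strictMono hij)
  intro a ha
  obtain ⟨i, rfl⟩ : a ∈ Set.range (A.orderEmbOfFin rfl) := by
    rw [Finset.range_orderEmbOfFin]
    exact ha
  rw [key f hf rfl, key g hg h.symm]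

section Homogeneity

variable (e : ℕ ≃ ℚ)

/-- Finite partial automorphisms of the rational order extend to automorphisms. -/
theorem exists_mem_autQ_extending (A : Finset ℕ) (h : ℕ → ℕ)
    (hA : ∀ a ∈ A, ∀ b ∈ A, e (h a) < e (h b) ↔ e a < e b) :
    ∃ g ∈ autQ e, ∀ a ∈ A, g a = h a := by
  obtain ⟨g, hg⟩ := exists_orderIso_extending (α := ℚ) (β := ℚ)
    ⟨A.image fun a => (e a, e (h a)), by
      intro p hp q hq
      obtain ⟨a, ha, rfl⟩ := Finset.mem_image.1 hp
      obtain ⟨b, hb, rfl⟩ := Finset.mem_image.1 hq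
      rcases lt_trichotomy (e a) (e b) with hab | hab | hab
      · exact (hab.cmp_eq_lt).trans ((hA a ha b hb).2 hab).cmp_eq_lt.symm
      · rw [hab, e.injective hab, cmp_self_eq_eq, cmp_self_eq_eq]
      · exact (hab.cmp_eq_gt).trans ((hA b hb a ha).2 hab).cmp_eq_gt.symm⟩
  refine ⟨(e.trans g.toEquiv).trans e.symm, fun i j => by simp, fun a ha => ?_⟩
  have := hg (e a, e (h a)) (Finset.mem_image_of_mem _ ha)
  simp only at this
  simp [this]

/-- The increasing bijection between the two finite sets of rationals is a partial automorphism,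
hence extends. Its value `0` off `A` plays no role. -/
theorem exists_mem_autQ_image_eq {A B : Finset ℕ} (h : A.card = B.card) :
    ∃ g ∈ autQ e, A.image g = B := by
  have hA : (A.image e).card = A.card := Finset.card_image_of_injective _ e.injective
  have hB : (B.image e).card = A.card := by
    rw [Finset.card_image_of_injective _ e.injective, h]
  let φ : (A.image e : Finset ℚ) ≃o (B.image e : Finset ℚ) :=
    ((A.image e).orderIsoOfFin hA).symm.trans ((B.image e).orderIsoOfFin hB)
  obtain ⟨g, hg, hgA⟩ := exists_mem_autQ_extending e A
    (fun a => if ha : e a ∈ A.image e then e.symm (φ ⟨e a, ha⟩) else 0) (by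
      intro a ha b hb
      rw [dif_pos (Finset.mem_image_of_mem _ ha), dif_pos (Finset.mem_image_of_mem _ hb)]
      simp)
  refine ⟨g, hg, Finset.eq_of_subset_of_card_le ?_ ?_⟩
  · intro b hb
    obtain ⟨a, ha, rfl⟩ := Finset.mem_image.1 hb
    rw [hgA a ha, dif_pos (Finset.mem_image_of_mem _ ha)]
    obtain ⟨b, hb, hbe⟩ := Finset.mem_image.1 (φ ⟨e a, Finset.mem_image_of_mem _ ha⟩).2
    rwa [← hbe, e.symm_apply_apply]
  · rw [Finset.card_image_of_injective _ g.injective, h]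

/-- Finite linear orders are rigid. This lets finite sets stand for cosets of a pointwise
stabilizer, so that Ramsey's theorem for sets applies. -/
theorem eqOn_of_mem_autQ {A : Finset ℕ} {g k : Sinf} (hg : g ∈ autQ e) (hk : k ∈ autQ e)
    (h : A.image g = A.image k) : ∀ a ∈ A, g a = k a := by
  classical
  have := eqOn_of_strictMonoOn_of_image_eq (A := A.image e) (f := fun q => e (g (e.symm q)))
    (g := fun q => e (k (e.symm q)))
    (fun x _ y _ hxy => by simpa [hg (e.symm x) (e.symm y)] using hxy)
    (fun x _ y _ hxy => by simpa [hk (e.symm x) (e.symm y)] using hxy) (by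
      have := congrArg (Finset.image e) h
      simpa [Finset.image_image, Function.comp_def] using this)
  intro a ha
  simpa using this (e a) (Finset.mem_image_of_mem _ ha)

end Homogeneity

/-! ## Neighbourhoods of the identity and extreme amenability -/

/-- The pointwise stabilizers of finite sets form a neighbourhood basis of `1`. -/
theorem mem_nhds_one_Sinf_iff {s : Set Sinf} :
    s ∈ 𝓝 (1 : Sinf) ↔ ∃ A : Finset ℕ, ∀ u : Sinf, (∀ a ∈ A, u a = a) → u ∈ s := by
  constructor
  · intro hs
    rw [nhds_induced, mem_comap] at hs
    obtain ⟨t, ht, hts⟩ := hs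
    rw [nhds_pi, Filter.mem_pi'] at ht
    obtain ⟨A, v, hv, hvt⟩ := ht
    refine ⟨A, fun u hu => hts (hvt fun a ha => ?_)⟩
    change u a ∈ v a
    rw [hu a ha]
    exact mem_of_mem_nhds (hv a)
  · rintro ⟨A, hA⟩
    have : ∀ᶠ u in 𝓝 (1 : Sinf), ∀ a ∈ A, u a = a := by
      rw [Filter.eventually_all_finset]
      exact fun a _ => Sinf_eventually_apply 1 a
    exact Filter.mem_of_superset this hA

/-- In a compact flow, small group elements move all points by little. -/
theorem eventually_forall_smul_mem {G X : Type*} [Group G] [TopologicalSpace G] [UniformSpace X]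
    [CompactSpace X] [MulAction G X] [ContinuousSMul G X] {V : Set (X × X)} (hV : V ∈ 𝓤 X) :
    ∀ᶠ u in 𝓝 (1 : G), ∀ x : X, (x, u • x) ∈ V := by
  have := isCompact_univ.eventually_forall_of_forall_eventually (x₀ := (1 : G))
    (K := (Set.univ : Set X)) (P := fun u x => (x, u • x) ∈ V) fun x _ => by
      have hc : Continuous fun p : G × X => (p.2, p.1 • p.2) := by fun_prop
      refine hc.continuousAt.eventually ?_
      change ∀ᶠ y in 𝓝 (x, (1 : G) • x), y ∈ V
      rw [one_smul]
      exact nhds_le_uniformity x hV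
  simpa using this

/-- The automorphism group of the rational order is extremely amenable. -/
theorem isExtremelyAmenable_autQ (e : ℕ ≃ ℚ) : IsExtremelyAmenable.{0, u} (autQ e) := by
  classical
  intro X _ _ hX
  have := hX.nonempty
  have := hX.compact
  have := hX.t2
  have := hX.continuous_smul
  let _ : UniformSpace X := uniformSpaceOfCompactR1
  obtain ⟨x₀⟩ := hX.nonempty
  -- Almost fixed points, for finitely many group elements and one entourage.
  have key : ∀ V ∈ 𝓤 X, ∀ F : Finset (autQ e), ∃ x : X, ∀ h ∈ F, (x, h • x) ∈ V := by
    intro V hV F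
    obtain ⟨W', hW', hsymm', hcomp'⟩ := comp_symm_mem_uniformity_sets hV
    obtain ⟨W, hW, hsymm, hcomp⟩ := comp_symm_mem_uniformity_sets hW'
    obtain ⟨A, hA⟩ : ∃ A : Finset ℕ, ∀ u : autQ e, (∀ a ∈ A, (u : Sinf) a = a) →
        ∀ x : X, (x, u • x) ∈ W := by
      have h1 := eventually_forall_smul_mem (G := autQ e) hW
      rw [Filter.Eventually, nhds_subtype, mem_comap] at h1
      obtain ⟨t, ht, hts⟩ := h1
      obtain ⟨A, hA⟩ := mem_nhds_one_Sinf_iff.1 ht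
      exact ⟨A, fun u hu => hts (hA u hu)⟩
    obtain ⟨t, htf, ht⟩ := isCompact_univ.totallyBounded (α := X) W hW
    have := htf.to_subtype
    have hγ : ∀ s : Finset ℕ, ∃ g : autQ e, s.card = A.card → A.image (g⁻¹ : autQ e).1 = s := by
      intro s
      by_cases hs : s.card = A.card
      · obtain ⟨g, hg, hgs⟩ := exists_mem_autQ_image_eq e hs.symm
        exact ⟨⟨g, hg⟩⁻¹, fun _ => by simpa using hgs⟩
      · exact ⟨1, fun h => (hs h).elim⟩
    choose γ hγ using hγ
    -- The colour of `s` is a point of the finite `W`-net `t` near `γ s • x₀`.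
    have hχ : ∀ s : Finset ℕ, ∃ c : t, (γ s • x₀, c.1) ∈ W := by
      intro s
      obtain ⟨c, hc, hcW⟩ := Set.mem_iUnion₂.1 (ht (Set.mem_univ (γ s • x₀)))
      exact ⟨⟨c, hc⟩, hcW⟩
    choose χ hχ using hχ
    obtain ⟨c, hc⟩ := exists_monochromatic χ A.card
    -- Once `k` maps this union onto `S`, the sets `k A` and `k h⁻¹ A` lie in `S`, so `k⁻¹ • x₀` and
    -- each `h k⁻¹ • x₀` are close to the same `c`.
    obtain ⟨S, hScard, hS⟩ := hc (A ∪ F.biUnion fun h => A.image (h⁻¹ : autQ e).1).card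
    obtain ⟨k, hk, hkS⟩ := exists_mem_autQ_image_eq e hScard.symm
    have hclose : ∀ g : autQ e, A.image (g⁻¹ : autQ e).1 ⊆ S → (g • x₀, c.1) ∈ W' := by
      intro g hg
      set s := A.image (g⁻¹ : autQ e).1 with hs
      have hcard : s.card = A.card := Finset.card_image_of_injective _ (Equiv.injective _)
      have heq := eqOn_of_mem_autQ e (γ s)⁻¹.2 g⁻¹.2 ((hγ s hcard).trans hs)
      have hfix : ∀ a ∈ A, ((γ s * g⁻¹ : autQ e) : Sinf) a = a := by
        intro a ha
        rw [Subgroup.coe_mul, Equiv.Perm.mul_apply, ← heq a ha]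
        simp
      have h1 := hA _ hfix (g • x₀)
      rw [smul_smul, inv_mul_cancel_right] at h1
      have h2 := hχ s
      rw [hS s hg hcard] at h2
      exact hcomp ⟨_, h1, h2⟩
    refine ⟨(⟨k, hk⟩ : autQ e)⁻¹ • x₀, fun h hh => hcomp' ⟨c.1, hclose _ ?_, ?_⟩⟩
    · rw [inv_inv, ← hkS]
      exact Finset.image_subset_image Finset.subset_union_left
    · rw [smul_smul]
      refine hsymm'.symm _ _ (hclose _ ?_)
      rw [mul_inv_rev, inv_inv, ← hkS]
      refine subset_trans (Eq.subset ?_) (Finset.image_subset_image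
        ((Finset.subset_biUnion_of_mem (fun h : autQ e => A.image (h⁻¹ : autQ e).1) hh).trans
          Finset.subset_union_right))
      rw [Finset.image_image]
      rfl
  -- Closed entourages make these sets closed; `key` gives the finite intersection property.
  have hne : (⋂ i : {V : Set (X × X) // V ∈ 𝓤 X ∧ IsClosed V} × autQ e,
      {x : X | (x, i.2 • x) ∈ i.1.1}).Nonempty := by
    refine CompactSpace.iInter_nonempty (fun i => ?_) fun I => ?_
    · exact i.1.2.2.preimage (by fun_prop)
    · obtain ⟨x, hx⟩ := key (⋂ i ∈ I, i.1.1) ((Filter.biInter_finset_mem I).2 fun i _ => i.1.2.1)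
        (I.image Prod.snd)
      exact ⟨x, Set.mem_iInter₂.2 fun i hi =>
        Set.mem_iInter₂.1 (hx i.2 (Finset.mem_image_of_mem _ hi)) i hi⟩
  obtain ⟨x, hx⟩ := hne
  refine ⟨x, fun g => (eq_of_uniformity_basis uniformity_hasBasis_closed fun {V} hV => ?_).symm⟩
  exact Set.mem_iInter.1 hx (⟨V, hV⟩, g)

/-! ## The space of linear orderings as a minimal flow -/

theorem LO_smul_apply (σ : Sinf) (r : LO) (i j : ℕ) :
    (σ • r).1 (i, j) = r.1 (σ⁻¹ i, σ⁻¹ j) := rfl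

theorem isStrictTotalOrder_LO (r : LO) : IsStrictTotalOrder ℕ fun i j => r.1 (i, j) = true := r.2

theorem LO_ext {r s : LO} (h : ∀ i j, r.1 (i, j) = true ↔ s.1 (i, j) = true) : r = s :=
  Subtype.ext (funext fun p => Bool.eq_iff_iff.2 (h p.1 p.2))

/-- The entourages of `LO` are generated by agreement on finite sets. -/
theorem mem_uniformity_LO_iff {V : Set (LO × LO)} :
    V ∈ 𝓤 LO ↔ ∃ A : Finset ℕ, ∀ r s : LO,
      (∀ i ∈ A, ∀ j ∈ A, r.1 (i, j) = s.1 (i, j)) → (r, s) ∈ V := by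
  classical
  constructor
  · intro hV
    rw [uniformity_subtype, mem_comap] at hV
    obtain ⟨t, ht, htV⟩ := hV
    rw [Pi.uniformity, Filter.mem_iInf'] at ht
    obtain ⟨I, hI, v, hv, -, rfl, -⟩ := ht
    refine ⟨hI.toFinset.image Prod.fst ∪ hI.toFinset.image Prod.snd, fun r s hrs => htV ?_⟩
    refine Set.mem_iInter₂.2 fun p hp => ?_
    obtain ⟨w, hw, hwv⟩ := mem_comap.1 (hv p)
    refine hwv (mem_uniformity_of_eq (x := r.1 p) (y := s.1 p) hw ?_)
    have hp' : p ∈ hI.toFinset := hI.mem_toFinset.2 hp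
    exact hrs p.1 (Finset.mem_union_left _ (Finset.mem_image_of_mem _ hp')) p.2
      (Finset.mem_union_right _ (Finset.mem_image_of_mem _ hp'))
  · rintro ⟨A, hA⟩
    have h : ∀ᶠ p in 𝓤 LO, ∀ i ∈ A, ∀ j ∈ A, p.1.1 (i, j) = p.2.1 (i, j) := by
      rw [Filter.eventually_all_finset]
      intro i _
      rw [Filter.eventually_all_finset]
      intro j _
      have hc : UniformContinuous fun r : LO => r.1 (i, j) :=
        (Pi.uniformContinuous_proj _ (i, j)).comp uniformContinuous_subtype_val
      exact hc (show SetRel.id ∈ 𝓤 Bool from mem_principal_self _)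
    exact Filter.mem_of_superset h fun p hp => hA p.1 p.2 hp

theorem isClosed_LO : IsClosed LO := by
  have h : LO = {r | ∀ i j k, r (i, i) = false ∧ (r (i, j) = true ∨ r (j, i) = true ∨ i = j) ∧
      (r (i, j) = true → r (j, k) = true → r (i, k) = true)} := by
    ext r
    constructor
    · intro hr i j k
      have hr : IsStrictTotalOrder ℕ fun i j => r (i, j) = true := hr
      refine ⟨by simpa using hr.irrefl i, ?_, hr.trans i j k⟩
      by_cases h1 : r (i, j) = true
      · exact Or.inl h1
      by_cases h2 : r (j, i) = true
      · exact Or.inr (Or.inl h2)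
      exact Or.inr (Or.inr (hr.trichotomous i j h1 h2))
    · intro hr
      exact
        { trichotomous := fun i j h1 h2 =>
            (((hr i j i).2.1.resolve_left h1).resolve_left h2)
          irrefl := fun i h => by simp [(hr i i i).1] at h
          trans := fun i j k => (hr i j k).2.2 }
  rw [h]
  simp only [Set.ofPred_forall]
  refine isClosed_iInter fun i => isClosed_iInter fun j => isClosed_iInter fun k => ?_
  -- For fixed `i`, `j`, `k` only five coordinates matter, and they range over a discrete space.
  have : {r : ℕ × ℕ → Bool | r (i, i) = false ∧ (r (i, j) = true ∨ r (j, i) = true ∨ i = j) ∧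
      (r (i, j) = true → r (j, k) = true → r (i, k) = true)} =
      (fun r : ℕ × ℕ → Bool => (r (i, i), r (i, j), r (j, i), r (j, k), r (i, k))) ⁻¹'
        {b | b.1 = false ∧ (b.2.1 = true ∨ b.2.2.1 = true ∨ i = j) ∧
          (b.2.1 = true → b.2.2.2.1 = true → b.2.2.2.2 = true)} := rfl
  rw [this]
  exact (isClosed_discrete _).preimage (by fun_prop)

instance : CompactSpace LO := isCompact_iff_compactSpace.1 isClosed_LO.isCompact

instance : ContinuousSMul Sinf LO where
  continuous_smul := by
    refine Continuous.subtype_mk (continuous_pi fun p => ?_) _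
    rw [continuous_iff_continuousAt]
    rintro ⟨σ, r⟩
    have h1 := (continuous_fst.tendsto (σ, r)).eventually
      ((continuous_inv.tendsto σ).eventually (Sinf_eventually_apply σ⁻¹ p.1))
    have h2 := (continuous_fst.tendsto (σ, r)).eventually
      ((continuous_inv.tendsto σ).eventually (Sinf_eventually_apply σ⁻¹ p.2))
    have hc : Continuous fun q : Sinf × LO => q.2.1 (σ⁻¹ p.1, σ⁻¹ p.2) :=
      ((continuous_apply _).comp continuous_subtype_val).comp continuous_snd
    refine hc.continuousAt.congr ?_
    filter_upwards [h1, h2] with q hq1 hq2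
    rw [← hq1, ← hq2]

theorem exists_equiv_fin_of_isStrictTotalOrder {α : Type*} [Fintype α] (t : α → α → Prop)
    [IsStrictTotalOrder α t] : ∃ φ : Fin (Fintype.card α) ≃ α, ∀ i j, t (φ i) (φ j) ↔ i < j := by
  classical
  let _ : LinearOrder α := linearOrderOfSTO t
  let ψ := monoEquivOfFin α rfl
  exact ⟨ψ.toEquiv, fun i j => ψ.lt_iff_lt⟩

/-- Any two linear orderings of a finite set of natural numbers are conjugate under a permutation
of the natural numbers. -/
theorem exists_perm_smul_eqOn (r s : LO) (A : Finset ℕ) :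
    ∃ σ : Sinf, ∀ i ∈ A, ∀ j ∈ A, (σ • r).1 (i, j) = s.1 (i, j) := by
  classical
  obtain ⟨r, hr⟩ := r
  obtain ⟨s, hs⟩ := s
  have hr : IsStrictTotalOrder ℕ fun i j => r (i, j) = true := hr
  have hs : IsStrictTotalOrder ℕ fun i j => s (i, j) = true := hs
  obtain ⟨φ, hφ⟩ : ∃ φ : A ≃ A, ∀ i j : A, r (φ i, φ j) = true ↔ s (i, j) = true := by
    have key : ∀ t : ℕ × ℕ → Bool, IsStrictTotalOrder ℕ (fun i j => t (i, j) = true) →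
        ∃ φ : Fin (Fintype.card A) ≃ A, ∀ i j, t (φ i, φ j) = true ↔ i < j := by
      intro t ht
      have : IsStrictTotalOrder A fun i j : A => t (i, j) = true :=
        { trichotomous := fun i j h1 h2 => Subtype.ext (ht.trichotomous i j h1 h2)
          irrefl := fun i => ht.irrefl i
          trans := fun i j k => ht.trans i j k }
      exact exists_equiv_fin_of_isStrictTotalOrder fun i j : A => t (i, j) = true
    obtain ⟨φ, hφ⟩ := key r hr
    obtain ⟨ψ, hψ⟩ := key s hs
    exact ⟨ψ.symm.trans φ, fun i j => by
      rw [Equiv.trans_apply, Equiv.trans_apply, hφ, ← hψ]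
      simp⟩
  -- The inverse appears because the action evaluates the order at `σ⁻¹`.
  refine ⟨(Equiv.Perm.ofSubtype φ)⁻¹, fun i hi j hj => Bool.eq_iff_iff.2 ?_⟩
  rw [LO_smul_apply, inv_inv, Equiv.Perm.ofSubtype_apply_of_mem φ hi,
    Equiv.Perm.ofSubtype_apply_of_mem φ hj]
  exact hφ ⟨i, hi⟩ ⟨j, hj⟩

/-- The ordering of the natural numbers transported from the rational numbers. -/
def rationalOrder (e : ℕ ≃ ℚ) : LO :=
  ⟨fun p => decide (e p.1 < e p.2),
    { trichotomous := fun i j h1 h2 => e.injective (by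
        simp only [decide_eq_true_eq, not_lt] at h1 h2
        exact le_antisymm h2 h1)
      irrefl := fun i => by simp
      trans := fun i j k => by simpa using lt_trans }⟩

theorem rationalOrder_apply (e : ℕ ≃ ℚ) (i j : ℕ) :
    (rationalOrder e).1 (i, j) = true ↔ e i < e j := decide_eq_true_iff

theorem dense_orbit_LO (r : LO) : Dense (MulAction.orbit Sinf r) := by
  intro s
  rw [mem_closure_iff_nhds]
  intro t ht
  obtain ⟨V, hV, hVt⟩ := UniformSpace.mem_nhds_iff.1 ht
  obtain ⟨A, hA⟩ := mem_uniformity_LO_iff.1 hV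
  obtain ⟨σ, hσ⟩ := exists_perm_smul_eqOn r s A
  exact ⟨σ • r, hVt (hA _ _ fun i hi j hj => (hσ i hi j hj).symm), σ, rfl⟩

theorem isMinimalFlow_LO : IsMinimalFlow Sinf LO where
  nonempty := ⟨rationalOrder (Denumerable.eqv ℚ).symm⟩
  compact := inferInstance
  t2 := inferInstance
  continuous_smul := inferInstance
  dense_orbit := dense_orbit_LO

/-! ## The completion of the coset space -/

section Cosets

variable (e : ℕ ≃ ℚ)

theorem smul_rationalOrder_apply (σ : Sinf) (i j : ℕ) :
    (σ • rationalOrder e).1 (i, j) = true ↔ e (σ⁻¹ i) < e (σ⁻¹ j) :=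
  rationalOrder_apply e _ _

theorem smul_rationalOrder_eq_of_mem {σ : Sinf} (hσ : σ ∈ autQ e) :
    σ • rationalOrder e = rationalOrder e :=
  LO_ext fun i j => by
    rw [smul_rationalOrder_apply, rationalOrder_apply]
    exact inv_mem hσ i j

/-- The map `gH ↦ g • <` from the coset space to the space of linear orderings. -/
def cosetToLO : Sinf ⧸ autQ e → LO :=
  Quotient.lift (fun σ : Sinf => σ • rationalOrder e) fun σ τ h => by
    have h := smul_rationalOrder_eq_of_mem e (QuotientGroup.leftRel_apply.1 h)
    rw [mul_smul, inv_smul_eq_iff] at h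
    exact h.symm

theorem cosetToLO_mk (σ : Sinf) : cosetToLO e (σ : Sinf ⧸ autQ e) = σ • rationalOrder e := rfl

theorem cosetToLO_smul (g : Sinf) (x : Sinf ⧸ autQ e) :
    cosetToLO e (g • x) = g • cosetToLO e x := by
  induction x using QuotientGroup.induction_on with
  | H σ => exact mul_smul g σ (rationalOrder e)

/-- Two cosets whose linear orderings agree on a finite set differ by a permutation that fixes this
set pointwise. -/
theorem exists_smul_eq_of_cosetToLO_eqOn {A : Finset ℕ} {x y : Sinf ⧸ autQ e}
    (h : ∀ i ∈ A, ∀ j ∈ A, (cosetToLO e x).1 (i, j) = (cosetToLO e y).1 (i, j)) :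
    ∃ u : Sinf, (∀ a ∈ A, u a = a) ∧ u • x = y := by
  classical
  induction x using QuotientGroup.induction_on with
  | H σ =>
  induction y using QuotientGroup.induction_on with
  | H τ =>
  -- The partial map `σ⁻¹ i ↦ τ⁻¹ i`, for `i ∈ A`, preserves the rational order because the two
  -- orderings agree on `A`.
  obtain ⟨k, hk, hkA⟩ := exists_mem_autQ_extending e (A.image (σ⁻¹ : Sinf))
    (fun a => τ⁻¹ (σ a)) (by
      intro a ha b hb
      obtain ⟨i, hi, rfl⟩ := Finset.mem_image.1 ha
      obtain ⟨j, hj, rfl⟩ := Finset.mem_image.1 hb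
      have := Bool.eq_iff_iff.1 (h i hi j hj)
      rw [cosetToLO_mk, cosetToLO_mk, smul_rationalOrder_apply, smul_rationalOrder_apply] at this
      simpa using this.symm)
  refine ⟨τ * k * σ⁻¹, fun a ha => ?_, ?_⟩
  · rw [Equiv.Perm.mul_apply, Equiv.Perm.mul_apply, hkA _ (Finset.mem_image_of_mem _ ha)]
    simp
  · change ((τ * k * σ⁻¹ * σ : Sinf) : Sinf ⧸ autQ e) = (τ : Sinf ⧸ autQ e)
    rw [inv_mul_cancel_right]
    exact QuotientGroup.mk_mul_of_mem τ hk

/-- Compactness of `LO` and equivariance give uniform continuity; homogeneity of `ℚ` gives the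
converse inclusion. -/
theorem isUniformInducing_cosetToLO : IsUniformInducing (cosetToLO e) := by
  refine ⟨Filter.ext fun s => ?_⟩
  change _ ↔ s ∈ cosetUniformity (autQ e)
  rw [mem_comap, mem_cosetUniformity]
  constructor
  · rintro ⟨V, hV, hVs⟩
    obtain ⟨U, hU⟩ := (eventually_forall_smul_mem (G := Sinf) hV).exists_mem
    refine ⟨U, hU.1, fun u hu x => hVs ?_⟩
    simpa only [Set.mem_preimage, cosetToLO_smul] using hU.2 u hu (cosetToLO e x)
  · rintro ⟨U, hU, hUs⟩
    obtain ⟨A, hA⟩ := mem_nhds_one_Sinf_iff.1 hU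
    refine ⟨{p | ∀ i ∈ A, ∀ j ∈ A, p.1.1 (i, j) = p.2.1 (i, j)},
      mem_uniformity_LO_iff.2 ⟨A, fun _ _ h => h⟩, ?_⟩
    rintro ⟨x, y⟩ h
    obtain ⟨u, hu, hxy⟩ := exists_smul_eq_of_cosetToLO_eqOn e h
    have h' := hUs u (hA u hu) x
    rwa [show u • x = y from hxy] at h'

theorem denseRange_cosetToLO : DenseRange (cosetToLO e) :=
  (dense_orbit_LO (rationalOrder e)).mono (by
    rintro _ ⟨σ, rfl⟩
    exact ⟨(σ : Sinf ⧸ autQ e), rfl⟩)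

/-- The space of linear orderings as a completion of `Sinf ⧸ autQ e`. -/
def completionLO : AbstractCompletion.{0, 0} (Sinf ⧸ autQ e) where
  space := LO
  coe := cosetToLO e
  uniformStruct := inferInstance
  complete := inferInstance
  separation := inferInstance
  isUniformInducing := isUniformInducing_cosetToLO e
  dense := denseRange_cosetToLO e

/-- The completion of `Sinf ⧸ autQ e` is isomorphic to the flow of linear orderings. -/
theorem flowIsomorphic_completion :
    FlowIsomorphic Sinf (UniformSpace.Completion (Sinf ⧸ autQ e)) LO := by
  let Φ : UniformSpace.Completion (Sinf ⧸ autQ e) ≃ᵤ LO :=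
    UniformSpace.Completion.cPkg.compareEquiv (completionLO e)
  have hΦ : ∀ x : Sinf ⧸ autQ e, Φ x = cosetToLO e x :=
    UniformSpace.Completion.cPkg.compare_coe (completionLO e)
  refine ⟨Φ.toHomeomorph, fun g x => ?_⟩
  change Φ (g • x) = g • Φ x
  induction x using UniformSpace.Completion.induction_on with
  | hp =>
    exact isClosed_eq (Φ.continuous.comp (continuous_const_smul g))
      ((continuous_const_smul g).comp Φ.continuous)
  | ih x => rw [← UniformSpace.Completion.coe_smul, hΦ, hΦ, cosetToLO_smul]

theorem isCoprecompact_autQ : IsCoprecompact (autQ e) := by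
  obtain ⟨Φ, -⟩ := flowIsomorphic_completion e
  exact Φ.symm.compactSpace

end Cosets

/-! ## Universality and uniqueness -/

/-- The flow of linear orderings maps to every flow of `Sinf`. -/
theorem exists_map_LO {Y : Type w} [TopologicalSpace Y] [MulAction Sinf Y] (hY : IsFlow Sinf Y) :
    ∃ π : LO → Y, Continuous π ∧ ∀ (g : Sinf) (r : LO), π (g • r) = g • π r := by
  have := hY.compact
  have := hY.t2
  have := hY.continuous_smul
  let _ : UniformSpace Y := uniformSpaceOfCompactR1
  let e : ℕ ≃ ℚ := (Denumerable.eqv ℚ).symm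
  obtain ⟨y, hy⟩ := isExtremelyAmenable_autQ e Y
    { nonempty := hY.nonempty
      compact := hY.compact
      t2 := hY.t2
      continuous_smul := inferInstance }
  let f : Sinf ⧸ autQ e → Y := Quotient.lift (fun σ : Sinf => σ • y) fun σ τ h => by
    have h := hy ⟨_, QuotientGroup.leftRel_apply.1 h⟩
    change (σ⁻¹ * τ) • y = y at h
    rw [mul_smul, inv_smul_eq_iff] at h
    exact h.symm
  have hf : ∀ (g : Sinf) (x : Sinf ⧸ autQ e), f (g • x) = g • f x := fun g x => by
    induction x using QuotientGroup.induction_on with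
    | H σ => exact mul_smul g σ y
  -- Coset entourages consist of pairs `(x, u • x)` with `u` near `1`, and such `u` move all points
  -- of the compact `Y` by little.
  have hfu : UniformContinuous f := by
    intro V hV
    refine mem_cosetUniformity.2 ?_
    obtain ⟨U, hU⟩ := (eventually_forall_smul_mem (G := Sinf) hV).exists_mem
    refine ⟨U, hU.1, fun u hu x => ?_⟩
    simpa only [Set.mem_preimage, hf] using hU.2 u hu (f x)
  let π : LO → Y := (completionLO e).extend f
  have hπ : Continuous π := (completionLO e).continuous_extend
  have hπf : ∀ x, π (cosetToLO e x) = f x := (completionLO e).extend_coe hfu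
  refine ⟨π, hπ, fun g r => ?_⟩
  refine (denseRange_cosetToLO e).induction_on (p := fun r => π (g • r) = g • π r) r
    (isClosed_eq (by fun_prop) (by fun_prop)) fun x => ?_
  rw [← cosetToLO_smul, hπf, hπf, hf]

theorem isUniversalMinimalFlow_LO : IsUniversalMinimalFlow.{0, 0, w} Sinf LO where
  toIsMinimalFlow := isMinimalFlow_LO
  exists_map _ _ _ hY := exists_map_LO hY.toIsFlow

/-- The linear orderings fixed by the automorphisms of the rational order are this order and its
reverse. -/
theorem eq_or_eq_of_autQ_fixed (e : ℕ ≃ ℚ) {r : LO} (hr : ∀ σ ∈ autQ e, σ • r = r) :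
    (∀ i j, r.1 (i, j) = true ↔ e i < e j) ∨ ∀ i j, r.1 (i, j) = true ↔ e j < e i := by
  have htr := isStrictTotalOrder_LO r
  -- Automorphisms act transitively on increasing pairs, so one value of `r` decides all.
  have hmove : ∀ i j k l, e i < e j → e k < e l → r.1 (i, j) = r.1 (k, l) := by
    intro i j k l hij hkl
    have hne : i ≠ j := by rintro rfl; exact lt_irrefl _ hij
    obtain ⟨σ, hσ, hσA⟩ := exists_mem_autQ_extending e {i, j} (fun a => if a = i then k else l) (by
      intro a ha b hb
      simp only [Finset.mem_insert, Finset.mem_singleton] at ha hb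
      rcases ha with rfl | rfl <;> rcases hb with rfl | rfl <;>
        simp [hne.symm, hij, hkl, hij.not_gt, hkl.not_gt])
    have h1 : σ i = k := by simpa using hσA i (by simp)
    have h2 : σ j = l := by simpa [hne.symm] using hσA j (by simp)
    have := hr σ hσ
    rw [← h1, ← h2]
    conv_rhs => rw [← this, LO_smul_apply]
    simp
  have hasymm : ∀ i j, r.1 (i, j) = true → ¬ r.1 (j, i) = true := fun i j h1 h2 =>
    htr.irrefl i (htr.trans i j i h1 h2)
  have h01 : e (e.symm 0) < e (e.symm 1) := by simp
  by_cases h : r.1 (e.symm 0, e.symm 1) = true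
  · have hlt : ∀ i j, e i < e j → r.1 (i, j) = true := fun i j hij =>
      (hmove _ _ _ _ hij h01).trans h
    refine Or.inl fun i j => ⟨fun hij => ?_, hlt i j⟩
    rcases lt_trichotomy (e i) (e j) with h' | h' | h'
    · exact h'
    · rw [e.injective h'] at hij
      exact (htr.irrefl j hij).elim
    · exact (hasymm i j hij (hlt j i h')).elim
  · have hlt : ∀ i j, e i < e j → ¬ r.1 (i, j) = true := fun i j hij h' =>
      h ((hmove _ _ _ _ hij h01).symm.trans h')
    refine Or.inr fun i j => ⟨fun hij => ?_, fun hij => ?_⟩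
    · rcases lt_trichotomy (e i) (e j) with h' | h' | h'
      · exact (hlt i j h' hij).elim
      · rw [e.injective h'] at hij
        exact (htr.irrefl j hij).elim
      · exact h'
    · by_contra h'
      exact hij.ne' (congrArg e (htr.trichotomous i j h' (hlt j i hij)))

/-- Equivariant continuous self-maps of the flow of linear orderings are injective. -/
theorem injective_of_LO_equivariant {f : LO → LO} (hf : Continuous f)
    (hfe : ∀ (g : Sinf) (r : LO), f (g • r) = g • f r) : Function.Injective f := by
  let e : ℕ ≃ ℚ := (Denumerable.eqv ℚ).symm
  have hfix : ∀ σ ∈ autQ e, σ • f (rationalOrder e) = f (rationalOrder e) := fun σ hσ => by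
    rw [← hfe, smul_rationalOrder_eq_of_mem e hσ]
  -- What `f` does to the rational order propagates along its dense orbit: `f` is the identity or
  -- order reversal.
  have key : (∀ r i j, (f r).1 (i, j) = r.1 (i, j)) ∨ ∀ r i j, (f r).1 (i, j) = r.1 (j, i) := by
    have hev : ∀ i j, Continuous fun r : LO => r.1 (i, j) := fun i j =>
      (continuous_apply _).comp continuous_subtype_val
    refine (eq_or_eq_of_autQ_fixed e hfix).imp (fun h r i j => ?_) fun h r i j => ?_
    · refine (dense_orbit_LO (rationalOrder e)).induction
        (P := fun r => (f r).1 (i, j) = r.1 (i, j)) ?_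
        (isClosed_eq ((hev i j).comp hf) (hev i j)) r
      rintro _ ⟨σ, rfl⟩
      change (f (σ • _)).1 _ = (σ • _ : LO).1 _
      rw [hfe, LO_smul_apply, LO_smul_apply, Bool.eq_iff_iff, h, rationalOrder_apply]
    · refine (dense_orbit_LO (rationalOrder e)).induction
        (P := fun r => (f r).1 (i, j) = r.1 (j, i)) ?_
        (isClosed_eq ((hev i j).comp hf) (hev j i)) r
      rintro _ ⟨σ, rfl⟩
      change (f (σ • _)).1 _ = (σ • _ : LO).1 _
      rw [hfe, LO_smul_apply, LO_smul_apply, Bool.eq_iff_iff, h, rationalOrder_apply]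
  intro r s hrs
  rcases key with h | h
  · exact LO_ext fun i j => by rw [← h r, ← h s, hrs]
  · exact LO_ext fun i j => by rw [← h r j i, ← h s j i, hrs]

/-- Equivariant continuous maps from a flow to a minimal flow are surjective. -/
theorem surjective_of_isMinimalFlow {G X Y : Type*} [Group G] [TopologicalSpace G]
    [TopologicalSpace X] [MulAction G X] [TopologicalSpace Y] [MulAction G Y]
    (hX : IsFlow G X) (hY : IsMinimalFlow G Y) {f : X → Y} (hf : Continuous f)
    (hfe : ∀ (g : G) (x : X), f (g • x) = g • f x) : Function.Surjective f := by
  have := hX.compact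
  have := hY.t2
  obtain ⟨x⟩ := hX.nonempty
  have hd : DenseRange f := (hY.dense_orbit (f x)).mono (by
    rintro _ ⟨g, rfl⟩
    exact ⟨g • x, hfe g x⟩)
  rw [← Set.range_eq_univ, ← (isCompact_range hf).isClosed.closure_eq]
  exact hd.closure_range

/-- Universality of `M : Type u` is tested on flows in `Type u` only, so `LO` must be lifted there.
-/
theorem isMinimalFlow_uliftLO : IsMinimalFlow Sinf (ULift.{u} LO) where
  nonempty := ⟨⟨rationalOrder (Denumerable.eqv ℚ).symm⟩⟩
  compact := inferInstance
  t2 := inferInstance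
  continuous_smul :=
    ⟨continuous_uliftUp.comp (continuous_fst.smul (continuous_uliftDown.comp continuous_snd))⟩
  dense_orbit r := by
    have h := Homeomorph.ulift.{u}.symm.surjective.denseRange.dense_image
      (Homeomorph.ulift.{u}.symm.continuous) (dense_orbit_LO r.down)
    refine h.mono ?_
    rintro _ ⟨_, ⟨σ, rfl⟩, rfl⟩
    exact ⟨σ, rfl⟩

/-- Every universal minimal flow of `Sinf` is isomorphic to the flow of linear orderings. -/
theorem flowIsomorphic_LO {M : Type u} [TopologicalSpace M] [MulAction Sinf M]
    (hM : IsUniversalMinimalFlow.{0, u, u} Sinf M) : FlowIsomorphic Sinf M LO := by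
  have := hM.compact
  have := hM.t2
  obtain ⟨ψ, hψ, hψe⟩ := hM.exists_map (ULift.{u} LO) isMinimalFlow_uliftLO
  obtain ⟨φ, hφ, hφe⟩ := exists_map_LO hM.toIsFlow
  -- The composite `LO → M → LO` is an equivariant self-map, hence injective.
  have hinj : Function.Injective φ := by
    refine (injective_of_LO_equivariant (f := fun r => (ψ (φ r)).down)
      (continuous_uliftDown.comp (hψ.comp hφ)) fun g r => ?_).of_comp
      (f := fun m => (ψ m).down)
    rw [hφe, hψe]
    rfl
  have hsurj := surjective_of_isMinimalFlow isMinimalFlow_LO.toIsFlow hM.toIsMinimalFlow hφ hφe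
  let Φ : LO ≃ₜ M :=
    hφ.homeoOfEquivCompactToT2 (f := Equiv.ofBijective φ ⟨hinj, hsurj⟩)
  refine ⟨Φ.symm, fun g x => ?_⟩
  obtain ⟨r, rfl⟩ := Φ.surjective x
  rw [Φ.symm_apply_apply, Φ.symm_apply_eq]
  exact (hφe g r).symm

end TopDyn

open TopDyn
theorem mainTheorem4 :
    IsUniversalMinimalFlow.{0, 0, u} Sinf LO ∧
    (∀ (M : Type u) [TopologicalSpace M] [MulAction Sinf M],
      IsUniversalMinimalFlow.{0, u, u} Sinf M → FlowIsomorphic Sinf M LO) ∧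
    (∀ e : ℕ ≃ ℚ,
      IsExtremelyAmenable.{0, u} (autQ e) ∧
      IsCoprecompact (autQ e) ∧
      FlowIsomorphic Sinf (UniformSpace.Completion (Sinf ⧸ autQ e)) LO) :=
  ⟨isUniversalMinimalFlow_LO, fun _ _ _ hM => flowIsomorphic_LO hM, fun e =>
    ⟨isExtremelyAmenable_autQ e, isCoprecompact_autQ e, flowIsomorphic_completion e⟩⟩
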